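/- Let $G$ be a (discrete) group, let $H\le G$ be a subgroup, and let $\mathcal H$ be a complex Hilbert space. Write $e$ for the identity of $G$ and $g/H$ for the coset $gH$. Let $\Gamma\subseteq G/H$ be symmetric (for every $g\in G$, if $g/H\in\Gamma$ then $g^{-1}/H\in\Gamma$) and Archimedean ($e/H\in\Gamma$), and let $\varphi:\Gamma\to\mathbf B(\mathcal H)$ be a function. Let $\mathbb C[\Gamma]\subseteq\mathbb C[G]$ be the linear span of the elements $g\in G$ with $g/H\in\Gamma$. A matrix over $\mathbb C[G]$ is positive semidefinite if it is so over the full group $C^*$-algebra of $G$, that is, if its image under every unitary representation of $G$ is a positive operator. We call $\varphi$ a partially defined completely positive definite function if the linear map $\hat\varphi:\mathbb C[\Gamma]\to\mathbf B(\mathcal H)$ with $\hat\varphi(g)=\varphi(g/H)$ is completely positive: for every $n$ it maps, entrywise, each $n\times n$ matrix over $\mathbb C[\Gamma]$ that is positive semidefinite over $\mathbb C[G]$ to a positive operator on $\mathcal H^n$. A unitary representation $\pi$ of $G$ (no continuity is required) on a Hilbert space $\mathcal K$ is of class one if the space $\mathcal K^H$ of its $H$-invariant vectors is nonzero. 1.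 $\varphi$ is a partially defined completely positive definite function if and only if there exist a unitary representation $\pi$ of $G$ of class one, on some Hilbert space $\mathcal K$, and a bounded operator $V:\mathcal H\to\mathcal K$ with range contained in $\mathcal K^H$ such that $$\varphi(g/H)=V^*\pi(g)V\qquad\text{for all } g\in G \text{ with } g/H\in\Gamma .$$ 2. $\varphi$ is a partially defined completely positive definite function with $\varphi(e/H)=I_{\mathcal H}$ if and only if there exist such a $\pi$ and an isometry $V:\mathcal H\to\mathcal K$ with range contained in $\mathcal K^H$ such that the same formula holds. -/

import Mathlib

universe u v w

namespace PartialCPD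

section Representations

variable {G : Type u} [Group G]
variable {K : Type v} [NormedAddCommGroup K] [InnerProductSpace ℂ K] [CompleteSpace K]

/-- The linear extension to the group algebra `ℂ[G]` of a unitary representation of `G`. -/
noncomputable def algRep (π : G →* unitary (K →L[ℂ] K)) :
    MonoidAlgebra ℂ G →ₐ[ℂ] (K →L[ℂ] K) :=
  MonoidAlgebra.lift ℂ (K →L[ℂ] K) G ((unitary (K →L[ℂ] K)).subtype.comp π)

/-- The subspace of vectors fixed by every element of the subgroup `H`. -/
def fixedVectors (H : Subgroup G) (π : G →* unitary (K →L[ℂ] K)) : Submodule ℂ K where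
  carrier := {ξ | ∀ h ∈ H, (π h : K →L[ℂ] K) ξ = ξ}
  add_mem' := by
    intro a b ha hb h hh
    rw [map_add, ha h hh, hb h hh]
  zero_mem' := by
    intro h _
    exact map_zero _
  smul_mem' := by
    intro c a ha h hh
    rw [map_smul, ha h hh]

/-- A unitary representation of `G` is of class one (with respect to `H`) if its space of
`H`-fixed vectors is non-trivial. -/
def IsClassOne (H : Subgroup G) (π : G →* unitary (K →L[ℂ] K)) : Prop :=
  fixedVectors H π ≠ ⊥

end Representations

section Positivity

open scoped ComplexOrder in
/-- An `n × n` matrix of bounded operators on `K` is positive semidefinite if it is a positive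
operator on the Hilbert space `K ⊕ ⋯ ⊕ K`. -/
def IsPosSemidefOp {K : Type v} [NormedAddCommGroup K] [InnerProductSpace ℂ K] {n : ℕ}
    (T : Matrix (Fin n) (Fin n) (K →L[ℂ] K)) : Prop :=
  ∀ ξ : Fin n → K, 0 ≤ ∑ i, ∑ j, inner ℂ (ξ i) (T i j (ξ j))

/-- Positive semidefiniteness of a matrix over `ℂ[G]` (`G` discrete), as a matrix over the full
group C⋆-algebra. The C⋆-norm on `ℂ[G]` is the supremum of the operator norms over all unitary
representations, so a matrix over `ℂ[G]` is positive exactly when its image under every unitary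
representation is a positive operator. Representations on Hilbert spaces in `Type u` already
suffice to test this (one may restrict to the closed invariant subspace generated by finitely many
vectors), so the notion does not depend on the choice of the universe `w`. -/
def IsPosSemidefAlg {G : Type u} [Group G] {n : ℕ}
    (x : Matrix (Fin n) (Fin n) (MonoidAlgebra ℂ G)) : Prop :=
  ∀ (K : Type (max u w)) [NormedAddCommGroup K] [InnerProductSpace ℂ K] [CompleteSpace K]
    (π : G →* unitary (K →L[ℂ] K)), IsPosSemidefOp (x.map (algRep π))

end Positivity

section HomogeneousSpace

variable {G : Type u} [Group G] {H : Subgroup G}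

/-- `Γ ⊆ G/H` is symmetric: `gH ∈ Γ` implies `g⁻¹H ∈ Γ`, for every `g ∈ G`. -/
def IsSymmetric (Γ : Set (G ⧸ H)) : Prop :=
  ∀ g : G, (g : G ⧸ H) ∈ Γ → ((g⁻¹ : G) : G ⧸ H) ∈ Γ

/-- `Γ ⊆ G/H` is Archimedean: it contains the base point `eH`. -/
def IsArchimedean (Γ : Set (G ⧸ H)) : Prop :=
  ((1 : G) : G ⧸ H) ∈ Γ

/-- `ℂ[Γ]`, the span in `ℂ[G]` of all `g ∈ G` with `gH ∈ Γ`. -/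
noncomputable def spanOver (Γ : Set (G ⧸ H)) : Submodule ℂ (MonoidAlgebra ℂ G) :=
  Submodule.span ℂ {x | ∃ g : G, (g : G ⧸ H) ∈ Γ ∧ x = MonoidAlgebra.of ℂ G g}

theorem of_mem_spanOver {Γ : Set (G ⧸ H)} {g : G} (hg : (g : G ⧸ H) ∈ Γ) :
    MonoidAlgebra.of ℂ G g ∈ spanOver Γ :=
  Submodule.subset_span ⟨g, hg, rfl⟩

variable {E : Type v} [NormedAddCommGroup E] [InnerProductSpace ℂ E]

open Classical in
/-- The linear map `ℂ[Γ] → B(E)` induced by `φ : Γ → B(E)`, that is, the one with `g ↦ φ(gH)`.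
(The value `0` is never used, as elements of `ℂ[Γ]` are supported on `{g | gH ∈ Γ}`.) -/
noncomputable def inducedMap (Γ : Set (G ⧸ H)) (φ : Γ → (E →L[ℂ] E)) :
    spanOver Γ →ₗ[ℂ] (E →L[ℂ] E) :=
  (Finsupp.linearCombination ℂ
      (fun g : G => if hg : (g : G ⧸ H) ∈ Γ then φ ⟨(g : G ⧸ H), hg⟩ else 0)
    ∘ₗ (MonoidAlgebra.coeffLinearEquiv ℂ).toLinearMap).domRestrict (spanOver Γ)

theorem inducedMap_of (Γ : Set (G ⧸ H)) (φ : Γ → (E →L[ℂ] E)) (g : G)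
    (hg : (g : G ⧸ H) ∈ Γ) :
    inducedMap Γ φ ⟨MonoidAlgebra.of ℂ G g, of_mem_spanOver hg⟩ = φ ⟨(g : G ⧸ H), hg⟩ := by
  simp [inducedMap, hg]

/-- A linear map `L : ℂ[Γ] → B(E)` is completely positive if, for every `n`, it maps those
`n × n` matrices over `ℂ[Γ]` that are positive semidefinite (as matrices over `ℂ[G]`) to positive
semidefinite matrices of operators. -/
def IsCompletelyPositive (Γ : Set (G ⧸ H)) (L : spanOver Γ →ₗ[ℂ] (E →L[ℂ] E)) : Prop :=
  ∀ (n : ℕ) (x : Matrix (Fin n) (Fin n) (spanOver Γ)),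
    IsPosSemidefAlg.{u, v} (x.map (fun y => (y : MonoidAlgebra ℂ G))) →
      IsPosSemidefOp (x.map L)

/-- `φ : Γ → B(E)` is a partially defined completely positive definite function if the linear map
`ℂ[Γ] → B(E)` it induces is completely positive. -/
def IsPartialCPD (Γ : Set (G ⧸ H)) (φ : Γ → (E →L[ℂ] E)) : Prop :=
  IsCompletelyPositive Γ (inducedMap Γ φ)

end HomogeneousSpace

end PartialCPD

/-!
A compression `V⋆ π(·) V` of a unitary representation is completely positive on all of `ℂ[G]`, which
gives one direction (`PartialCPD.isPartialCPD_of_compression`).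

For the other, `φ` is extended to a positive definite function on `G` and dilated. The extension is
Arveson's theorem in a guise that needs no topology. Consider finitely supported matrices over `ℂ[G]`
whose rows and columns are labelled by the set underlying the Hilbert space `E`, that is, elements of
`E × E × G →₀ ℂ`. Complete positivity of `φ` says that the functional `(ξ, η, g) ↦ ⟪ξ, φ(gH) η⟫`
is nonnegative on the positive matrices with entries in `ℂ[Γ]` (`PartialCPD.IsPartialCPD.nonneg`).
As `Γ` is Archimedean, these matrices dominate all others, so M. Riesz's theorem extends the
functional to a positive one, `b`, on all matrices (`Finsupp.exists_nonneg_extension`).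

Then `((ξ, g), (η, h)) ↦ b (ξ, η, g⁻¹ h)` is a positive semidefinite kernel on `E × G` invariant
under translation by `G`. It is the Gram kernel of a total family `ψ` in a Hilbert space
(`PartialCPD.exists_hilbertSpace_of_kernel`), on which `G` acts unitarily
(`PartialCPD.exists_unitaryRep_of_kernel`). Put `V ξ = ψ (ξ, 1)`. Nothing forces `b` to be
sesquilinear in `(ξ, η)`, but `⟪V ξ, V η⟫ = ⟪ξ, φ(eH) η⟫` because `eH ∈ Γ`, and this already makes
`V` linear and bounded. The same kind of norm computation shows that `V ξ` is fixed by `H`, and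
`V` is an isometry exactly when `φ(eH)` is the identity.
-/

section Auxiliary

open scoped ComplexOrder ComplexConjugate

/-! ### Extension of positive functionals -/

/-- A form of M. Riesz's extension theorem for spaces of finitely supported functions. A set `A` of
functions on `T`, Hermitian with respect to `τ`, declares `z : T →₀ ℂ` to be positive if `∑ z t • a t`
is nonnegative for all `a ∈ A`. If the elements supported on `D` dominate the whole space in this
order, then a functional on them that preserves positivity extends to a Hermitian functional on
`T →₀ ℂ` that preserves positivity. -/
theorem Finsupp.exists_nonneg_extension {T : Type*} (A : Set (T → ℂ)) (τ : T → T) (D : Set T)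
    (hτD : ∀ t ∈ D, τ t ∈ D)
    (hA : ∀ a ∈ A, ∀ t, a (τ t) = conj (a t))
    (hunit : ∀ t, ∃ x ∈ Finsupp.supported ℂ ℂ D,
      ∀ a ∈ A, (‖a t‖ : ℂ) ≤ Finsupp.linearCombination ℂ a x)
    (b : T → ℂ)
    (hb : ∀ z ∈ Finsupp.supported ℂ ℂ D, (∀ a ∈ A, 0 ≤ Finsupp.linearCombination ℂ a z) →
      0 ≤ Finsupp.linearCombination ℂ b z) :
    ∃ b' : T → ℂ, (∀ t ∈ D, b' t = b t) ∧ (∀ t, b' (τ t) = conj (b' t)) ∧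
      ∀ z, (∀ a ∈ A, 0 ≤ Finsupp.linearCombination ℂ a z) →
        0 ≤ Finsupp.linearCombination ℂ b' z := by
  -- Positivity on the domain forces `b` to be Hermitian there: apply it to the positive element
  -- `c t + c̄ τ(t) + 2x`, where `x` dominates `t`, and compare imaginary parts for `c = 1, i`.
  have hbτ : ∀ t ∈ D, b (τ t) = conj (b t) := by
    intro t ht
    obtain ⟨x, hxD, hx⟩ := hunit t
    have hbx : 0 ≤ Finsupp.linearCombination ℂ b x := hb x hxD fun a ha =>
      le_trans (by exact_mod_cast norm_nonneg _) (hx a ha)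
    have key : ∀ c : ℂ, ‖c‖ = 1 → (c * b t + conj c * b (τ t)).im = 0 := by
      intro c hc
      have h := hb (Finsupp.single t c + Finsupp.single (τ t) (conj c) + (2 : ℂ) • x)
        (add_mem (add_mem (Finsupp.single_mem_supported ℂ c ht)
          (Finsupp.single_mem_supported ℂ _ (hτD t ht))) (Submodule.smul_mem _ _ hxD)) (by
          intro a ha
          have h1 := hx a ha
          simp only [map_add, map_smul, Finsupp.linearCombination_single, hA a ha, smul_eq_mul]
          rw [Complex.le_def] at h1 ⊢
          have h2 : |(c * a t).re| ≤ ‖a t‖ := by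
            simpa [hc] using Complex.abs_re_le_norm (c * a t)
          have h3 := abs_le.1 h2
          simp at h1 h3 ⊢
          constructor
          · linarith [h1.1]
          · rw [← h1.2]; ring)
      simp only [map_add, map_smul, Finsupp.linearCombination_single, smul_eq_mul] at h
      have h2 := (Complex.le_def.1 h).2
      have h3 := (Complex.le_def.1 hbx).2
      simp at h2 h3 ⊢
      rw [← h3] at h2
      linarith
    have k1 := key 1 (by simp)
    have k2 := key Complex.I (by simp)
    simp at k1 k2
    apply Complex.ext <;> simp <;> linarith
  -- the conjugate-linear involution induced by `τ`
  let J : (T →₀ ℂ) → (T →₀ ℂ) := fun z =>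
    Finsupp.mapDomain τ (Finsupp.mapRange (starRingEnd ℂ) (map_zero _) z)
  have hJadd : ∀ z w, J (z + w) = J z + J w := fun z w => by
    simp only [J]
    rw [Finsupp.mapRange_add (map_add _), Finsupp.mapDomain_add]
  have hJ : ∀ (S : Set T) (a : T → ℂ), (∀ t ∈ S, a (τ t) = conj (a t)) →
      ∀ z ∈ Finsupp.supported ℂ ℂ S, Finsupp.linearCombination ℂ a (J z)
        = conj (Finsupp.linearCombination ℂ a z) := by
    intro S a ha z hz
    simp only [J]
    rw [Finsupp.linearCombination_mapDomain, Finsupp.linearCombination_apply,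
      Finsupp.sum_mapRange_index (by simp), Finsupp.linearCombination_apply, Finsupp.sum,
      Finsupp.sum, map_sum]
    refine Finset.sum_congr rfl fun t ht => ?_
    simp [ha t (hz ht)]
  have hJD : ∀ z ∈ Finsupp.supported ℂ ℂ D, J z ∈ Finsupp.supported ℂ ℂ D := by
    classical
    intro z hz
    rw [Finsupp.mem_supported] at hz ⊢
    intro t ht
    have := Finsupp.mapDomain_support ht
    obtain ⟨s, hs, rfl⟩ := Finset.mem_image.1 this
    exact hτD s (hz (Finsupp.support_mapRange hs))
  -- Working with real parts makes the cone live in all of `T →₀ ℂ`, so that no passage to the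
  -- real subspace of Hermitian elements is needed.
  let C : PointedCone ℝ (T →₀ ℂ) :=
    { carrier := {z | ∀ a ∈ A, 0 ≤ (Finsupp.linearCombination ℂ a z).re}
      add_mem' := fun hx hy a ha => by
        rw [map_add, Complex.add_re]; exact add_nonneg (hx a ha) (hy a ha)
      zero_mem' := fun a ha => by simp
      smul_mem' := fun c z hz a ha => by
        have : c • z = ((c : ℝ) : ℂ) • z := by
          ext t; simp
        rw [this, map_smul, smul_eq_mul, Complex.re_ofReal_mul]
        exact mul_nonneg c.2 (hz a ha) }
  -- the real part of the given functional, nonnegative on `C` because `z + J z` is positive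
  -- whenever `z ∈ C`
  let f : (T →₀ ℂ) →ₗ.[ℝ] ℝ :=
    { domain := (Finsupp.supported ℂ ℂ D).restrictScalars ℝ
      toFun := (Complex.reLm ∘ₗ (Finsupp.linearCombination ℂ b).restrictScalars ℝ).domRestrict _ }
  have hf : ∀ x : f.domain, f x = (Finsupp.linearCombination ℂ b (x : T →₀ ℂ)).re := fun _ => rfl
  obtain ⟨g, hg, hgC⟩ := riesz_extension C f (by
      rintro ⟨z, hz⟩ hzC
      have hzD : z ∈ Finsupp.supported ℂ ℂ D := hz
      have h := hb (z + J z) (add_mem hzD (hJD z hzD)) (by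
        intro a ha
        rw [map_add, hJ Set.univ a (fun t _ => hA a ha t) z (by simp), Complex.add_conj]
        have := hzC a ha
        exact_mod_cast (by linarith : 0 ≤ 2 * (Finsupp.linearCombination ℂ a z).re))
      rw [map_add, hJ D b hbτ z hzD, Complex.add_conj] at h
      have h' : 0 ≤ 2 * (Finsupp.linearCombination ℂ b z).re := by exact_mod_cast h
      rw [hf]
      simpa using h') (by
      intro y
      have : ∃ x ∈ Finsupp.supported ℂ ℂ D, x + y ∈ C := by
        induction y using Finsupp.induction_linear with
        | zero => exact ⟨0, zero_mem _, by simp⟩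
        | add y₁ y₂ h₁ h₂ =>
          obtain ⟨x₁, hx₁, h₁⟩ := h₁
          obtain ⟨x₂, hx₂, h₂⟩ := h₂
          refine ⟨x₁ + x₂, add_mem hx₁ hx₂, ?_⟩
          rw [add_add_add_comm]
          exact add_mem h₁ h₂
        | single t c =>
          obtain ⟨x, hxD, hx⟩ := hunit t
          refine ⟨(‖c‖ : ℂ) • x, Submodule.smul_mem _ _ hxD, fun a ha => ?_⟩
          have h1 : ‖a t‖ ≤ (Finsupp.linearCombination ℂ a x).re := by
            simpa using (Complex.le_def.1 (hx a ha)).1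
          rw [map_add, map_smul, Finsupp.linearCombination_single, smul_eq_mul, smul_eq_mul,
            Complex.add_re, Complex.re_ofReal_mul]
          have h2 := (abs_le.1 (Complex.abs_re_le_norm (c * a t))).1
          rw [norm_mul] at h2
          nlinarith [norm_nonneg c, mul_le_mul_of_nonneg_left h1 (norm_nonneg c)]
      obtain ⟨x, hx, hxy⟩ := this
      exact ⟨⟨x, hx⟩, hxy⟩)
  -- skew-Hermitian elements lie in both `C` and `-C`
  have hg0 : ∀ z, (∀ a ∈ A, (Finsupp.linearCombination ℂ a z).re = 0) → g z = 0 := by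
    intro z hz
    refine le_antisymm ?_ (hgC z fun a ha => (hz a ha).ge)
    have := hgC (-z) fun a ha => by rw [map_neg, Complex.neg_re, hz a ha, neg_zero]
    rw [map_neg] at this
    linarith
  let F : (T →₀ ℂ) →ₗ[ℂ] ℂ := Module.Dual.extendRCLike (𝕜 := ℂ) g
  have hFre : ∀ z, (F z).re = g z := fun z => Module.Dual.re_extendRCLike_apply (𝕜 := ℂ) g z
  have hFim : ∀ z, (F z).im = - g (Complex.I • z) := fun z =>
    Module.Dual.im_extendRCLike_apply (𝕜 := ℂ) g z
  have hFb : Finsupp.linearCombination ℂ (fun t => F (Finsupp.single t 1)) = F := by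
    ext t; simp
  refine ⟨fun t => F (Finsupp.single t 1), ?_, ?_, ?_⟩
  · intro t ht
    have hgt : ∀ c : ℂ, g (Finsupp.single t c) = (c * b t).re := fun c => by
      rw [hg ⟨Finsupp.single t c, Finsupp.single_mem_supported ℂ c ht⟩, hf]
      simp
    apply Complex.ext
    · simp [hFre, hgt]
    · simp [hFim, hgt]
  · intro t
    have h1 : g (Finsupp.single (τ t) 1 - Finsupp.single t 1) = 0 := hg0 _ fun a ha => by
      simp [hA a ha]
    have h2 : g (Finsupp.single (τ t) Complex.I + Finsupp.single t Complex.I) = 0 :=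
      hg0 _ fun a ha => by simp [hA a ha]
    rw [map_sub] at h1
    rw [map_add] at h2
    apply Complex.ext
    · simp only [Complex.conj_re, hFre]; linarith
    · simp only [Complex.conj_im, hFim, Finsupp.smul_single, smul_eq_mul, mul_one]; linarith
  · intro z hz
    rw [hFb, Complex.le_def, hFre, hFim, hg0 (Complex.I • z) fun a ha => ?_]
    · exact ⟨hgC z fun a ha => (Complex.le_def.1 (hz a ha)).1, by simp⟩
    · rw [map_smul, smul_eq_mul, Complex.I_mul_re, ← (Complex.le_def.1 (hz a ha)).2]
      simp

namespace PartialCPD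

/-! ### Hilbert spaces and representations from kernels -/

/-- Kolmogorov decomposition: a positive semidefinite kernel is the Gram kernel of a total family of
vectors in a Hilbert space. -/
theorem exists_hilbertSpace_of_kernel {X : Type u} (k : X → X → ℂ)
    (hk : ∀ x y, conj (k x y) = k y x)
    (hpos : ∀ c : X →₀ ℂ, 0 ≤ (c.sum fun x s => c.sum fun y t => conj s * t * k x y).re) :
    ∃ (K : Type u) (_ : NormedAddCommGroup K) (_ : InnerProductSpace ℂ K)
      (_ : CompleteSpace K) (ψ : X → K),
      (∀ x y, inner ℂ (ψ x) (ψ y) = k x y) ∧ DenseRange (Finsupp.linearCombination ℂ ψ) := by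
  -- scalar kernels are operator-valued kernels with values in `ℂ →L[ℂ] ℂ`
  let M : Matrix X X (ℂ →L[ℂ] ℂ) := Matrix.of fun x y => k x y • 1
  have hM : M.PosSemidef := by
    have htfae := (RKHS.posSemidef_tfae (𝕜 := ℂ) (K := M)).out 0 2
    refine htfae.mpr ⟨?_, fun c => ?_⟩
    · refine Matrix.IsHermitian.ext fun x y => ?_
      simp [M, ← hk y x]
    · refine (hpos c).trans_eq (congrArg Complex.re ?_)
      refine Finset.sum_congr rfl fun x _ => Finset.sum_congr rfl fun y _ => ?_
      simp [M, hk, mul_comm, mul_left_comm]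
  have : Fact M.PosSemidef := ⟨hM⟩
  refine ⟨RKHS.OfKernel M, inferInstance, inferInstance, inferInstance,
    fun x => RKHS.kerFun (RKHS.OfKernel M) x 1, fun x y => ?_, ?_⟩
  · rw [← RKHS.kernel_inner, RKHS.OfKernel.kernel_ofKernel]
    simp [M, hk]
  · have h := RKHS.kerFun_dense (RKHS.OfKernel M)
    rw [← Submodule.dense_iff_topologicalClosure_eq_top] at h
    rw [DenseRange, ← LinearMap.coe_range, Finsupp.range_linearCombination]
    refine h.mono (Submodule.span_le.2 ?_)
    rintro _ ⟨x, c, rfl⟩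
    have : RKHS.kerFun (RKHS.OfKernel M) x c = c • RKHS.kerFun (RKHS.OfKernel M) x 1 := by
      rw [← map_smul, smul_eq_mul, mul_one]
    rw [this]
    exact Submodule.smul_mem _ _ (Submodule.subset_span ⟨x, rfl⟩)

/-- A group acting on the index set of a total family and preserving its Gram kernel acts unitarily
on the Hilbert space. -/
theorem exists_unitaryRep_of_kernel {G : Type v} [Group G] {X : Type u} [MulAction G X]
    {K : Type w} [NormedAddCommGroup K] [InnerProductSpace ℂ K] [CompleteSpace K] (ψ : X → K)
    (hψ : DenseRange (Finsupp.linearCombination ℂ ψ))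
    (hinv : ∀ (g : G) x y, inner ℂ (ψ (g • x)) (ψ (g • y)) = inner ℂ (ψ x) (ψ y)) :
    ∃ π : G →* unitary (K →L[ℂ] K), ∀ g x, (π g : K →L[ℂ] K) (ψ x) = ψ (g • x) := by
  have hinner : ∀ (g : G) (c d : X →₀ ℂ),
      inner ℂ
        (Finsupp.linearCombination ℂ ψ
          (Finsupp.domLCongr (R := ℂ) (M := ℂ) (MulAction.toPerm g) c))
        (Finsupp.linearCombination ℂ ψ
          (Finsupp.domLCongr (R := ℂ) (M := ℂ) (MulAction.toPerm g) d)) =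
      inner ℂ (Finsupp.linearCombination ℂ ψ c) (Finsupp.linearCombination ℂ ψ d) := by
    intro g c d
    induction c using Finsupp.induction_linear with
    | zero => simp
    | add c₁ c₂ h₁ h₂ => simp only [map_add, inner_add_left, h₁, h₂]
    | single x s =>
      induction d using Finsupp.induction_linear with
      | zero => simp
      | add d₁ d₂ h₁ h₂ => simp only [map_add, inner_add_right, h₁, h₂]
      | single y t => simp [hinv]
  let U : G → (K ≃ₗᵢ[ℂ] K) := fun g =>
    (Finsupp.domLCongr (R := ℂ) (M := ℂ) (MulAction.toPerm g)).extendOfIsometry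
      (Finsupp.linearCombination ℂ ψ) (Finsupp.linearCombination ℂ ψ) hψ hψ fun c => by
        rw [@norm_eq_sqrt_re_inner ℂ, hinner, ← @norm_eq_sqrt_re_inner ℂ]
  have hU : ∀ g x, U g (ψ x) = ψ (g • x) := by
    intro g x
    have := LinearEquiv.extendOfIsometry_eq (Finsupp.domLCongr (R := ℂ) (M := ℂ)
      (MulAction.toPerm g)) (Finsupp.linearCombination ℂ ψ) (Finsupp.linearCombination ℂ ψ) hψ hψ
      (fun c => by rw [@norm_eq_sqrt_re_inner ℂ, hinner, ← @norm_eq_sqrt_re_inner ℂ])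
      (Finsupp.single x 1)
    simpa [U] using this
  have hext : ∀ S S' : K ≃ₗᵢ[ℂ] K, (∀ x, S (ψ x) = S' (ψ x)) → S = S' := by
    intro S S' h
    refine DFunLike.coe_injective (hψ.equalizer S.continuous S'.continuous ?_)
    funext c
    simp [Finsupp.linearCombination_apply, map_finsuppSum, h]
  let W : G →* (K ≃ₗᵢ[ℂ] K) :=
    { toFun := U
      map_one' := hext _ _ fun x => by simp [hU]
      map_mul' := fun g h => hext _ _ fun x => by simp [hU, mul_smul] }
  exact ⟨Unitary.linearIsometryEquiv.symm.toMonoidHom.comp W, fun g x => hU g x⟩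

theorem inner_self_eq_ofReal_norm_sq {K : Type w} [NormedAddCommGroup K] [InnerProductSpace ℂ K]
    (x : K) : inner ℂ x x = ((‖x‖ ^ 2 : ℝ) : ℂ) := by
  rw [inner_self_eq_norm_sq_to_K]; norm_cast

/-! ### Finitely supported matrices over the group algebra -/

section Blocks

variable {G : Type u} {E : Type v}

/-- An element of `E × E × G →₀ ℂ` is read as a finitely supported `E × E` matrix over `ℂ[G]`; this
is its entry at `(ξ, η)`. -/
noncomputable def block (z : E × E × G →₀ ℂ) (ξ η : E) : MonoidAlgebra ℂ G :=
  MonoidAlgebra.ofCoeff (z.comapDomain (fun g => (ξ, η, g)) (by intro g _ h _ e; simpa using e))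

theorem block_coeff_apply (z : E × E × G →₀ ℂ) (ξ η : E) (g : G) :
    (block z ξ η).coeff g = z (ξ, η, g) := rfl

/-- A finitely supported `E × E` matrix over `ℂ[G]` is a square matrix of finite size: all functionals
on it are computed from the entries at finitely many distinct points of `E`. -/
theorem exists_sum_block (z : E × E × G →₀ ℂ) :
    ∃ (n : ℕ) (p : Fin n → E), Function.Injective p ∧ ∀ a : E × E × G → ℂ,
      Finsupp.linearCombination ℂ a z = ∑ i, ∑ j,
        Finsupp.linearCombination ℂ (fun g => a (p i, p j, g)) (block z (p i) (p j)).coeff := by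
  classical
  let S : Finset E := z.support.image (fun t => t.1) ∪ z.support.image (fun t => t.2.1)
  let R : Finset G := z.support.image (fun t => t.2.2)
  have hS : z.support ⊆ S ×ˢ S ×ˢ R := fun t ht => by
    simp only [S, R, Finset.mem_product, Finset.mem_union, Finset.mem_image]
    exact ⟨Or.inl ⟨t, ht, rfl⟩, Or.inr ⟨t, ht, rfl⟩, ⟨t, ht, rfl⟩⟩
  refine ⟨S.card, fun i => (S.equivFin.symm i : E),
    Subtype.val_injective.comp S.equivFin.symm.injective, fun a => ?_⟩
  have hsum : ∀ f : E → ℂ, ∑ i, f (S.equivFin.symm i : E) = ∑ ξ ∈ S, f ξ := fun f => by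
    rw [S.equivFin.symm.sum_comp (fun ξ : S => f ξ), Finset.sum_coe_sort]
  simp only [fun ξ => hsum fun η =>
    Finsupp.linearCombination ℂ (fun g => a (ξ, η, g)) (block z ξ η).coeff]
  rw [hsum fun ξ => ∑ η ∈ S,
    Finsupp.linearCombination ℂ (fun g => a (ξ, η, g)) (block z ξ η).coeff]
  rw [Finsupp.linearCombination_apply, Finsupp.sum_of_support_subset z hS _ (by simp),
    Finset.sum_product]
  refine Finset.sum_congr rfl fun ξ _ => ?_
  rw [Finset.sum_product]
  refine Finset.sum_congr rfl fun η _ => ?_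
  rw [Finsupp.linearCombination_apply, Finsupp.sum_of_support_subset _ (s := R) _ _ (by simp)]
  · rfl
  · intro g hg
    have : (ξ, η, g) ∈ z.support := by
      rwa [Finsupp.mem_support_iff, block_coeff_apply,
        ← Finsupp.mem_support_iff] at hg
    exact Finset.mem_image.2 ⟨_, this, rfl⟩

end Blocks

/-! ### Matrix coefficients of unitary representations -/

section MatrixCoefficients

variable {G : Type u} [Group G] {E : Type v}

/-- The functions `(ξ, η, g) ↦ ⟪ψ ξ, π g (ψ η)⟫` for a unitary representation `π` of `G` on some `K`
and an arbitrary map `ψ : E → K`. They test positivity of finitely supported `E × E` matrices over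
`ℂ[G]`. No linearity of `ψ` is asked: the set `E` only labels rows and columns. -/
def matrixCoefficients (G : Type u) [Group G] (E : Type v) : Set (E × E × G → ℂ) :=
  {a | ∃ (K : Type (max u v)) (_ : NormedAddCommGroup K) (_ : InnerProductSpace ℂ K)
    (_ : CompleteSpace K) (π : G →* unitary (K →L[ℂ] K)) (ψ : E → K),
      a = fun t => inner ℂ (ψ t.1) ((π t.2.2 : K →L[ℂ] K) (ψ t.2.1))}

theorem matrixCoefficients_conj {a : E × E × G → ℂ} (ha : a ∈ matrixCoefficients G E)
    (t : E × E × G) : a (t.2.1, t.1, t.2.2⁻¹) = conj (a t) := by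
  obtain ⟨K, _, _, _, π, ψ, rfl⟩ := ha
  simp only [inner_conj_symm]
  rw [← Unitary.inner_map_map (π t.2.2), ← mul_apply_eq_comp,
    ← Submonoid.coe_mul, ← map_mul]
  simp

/-- The diagonal matrix units over the identity of `G` dominate every basis element. They have entries
in `ℂ[Γ]` exactly because `Γ` is Archimedean. -/
theorem norm_le_matrixCoefficients {a : E × E × G → ℂ} (ha : a ∈ matrixCoefficients G E)
    (t : E × E × G) : (‖a t‖ : ℂ) ≤ a (t.1, t.1, 1) + a (t.2.1, t.2.1, 1) := by
  obtain ⟨K, _, _, _, π, ψ, rfl⟩ := ha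
  have h := norm_inner_le_norm (𝕜 := ℂ) (ψ t.1) ((π t.2.2 : K →L[ℂ] K) (ψ t.2.1))
  rw [Unitary.norm_map] at h
  simp only [map_one, OneMemClass.coe_one, one_apply_eq_self, inner_self_eq_ofReal_norm_sq]
  have h2 : ‖inner ℂ (ψ t.1) ((π t.2.2 : K →L[ℂ] K) (ψ t.2.1))‖ ≤
      ‖ψ t.1‖ ^ 2 + ‖ψ t.2.1‖ ^ 2 := by
    nlinarith [sq_nonneg (‖ψ t.1‖ - ‖ψ t.2.1‖), norm_nonneg (ψ t.1), norm_nonneg (ψ t.2.1)]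
  exact_mod_cast h2

/-- The matrix tested here is `r⋆ r` for the row `r` whose entry at `ξ` is `∑ g, c (ξ, g) • g`. -/
theorem matrixCoefficients_gram_nonneg {a : E × E × G → ℂ} (ha : a ∈ matrixCoefficients G E)
    (c : E × G →₀ ℂ) :
    0 ≤ c.sum fun x s => c.sum fun y t => conj s * t * a (x.1, y.1, x.2⁻¹ * y.2) := by
  obtain ⟨K, _, _, _, π, ψ, rfl⟩ := ha
  have h : ∀ x y : E × G, inner ℂ (ψ x.1) ((π (x.2⁻¹ * y.2) : K →L[ℂ] K) (ψ y.1)) =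
      inner ℂ ((π x.2 : K →L[ℂ] K) (ψ x.1)) ((π y.2 : K →L[ℂ] K) (ψ y.1)) := fun x y => by
    rw [← Unitary.inner_map_map (π x.2), ← mul_apply_eq_comp (π x.2 : K →L[ℂ] K),
      ← Submonoid.coe_mul, ← map_mul, mul_inv_cancel_left]
  have h2 : (c.sum fun x s => c.sum fun y t => conj s * t *
      inner ℂ (ψ x.1) ((π (x.2⁻¹ * y.2) : K →L[ℂ] K) (ψ y.1))) =
      inner ℂ (c.sum fun x s => s • (π x.2 : K →L[ℂ] K) (ψ x.1))
        (c.sum fun x s => s • (π x.2 : K →L[ℂ] K) (ψ x.1)) := by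
    simp only [h, Finsupp.sum, sum_inner, inner_sum, inner_smul_left, inner_smul_right,
      Finset.mul_sum]
    rw [Finset.sum_comm]
    exact Finset.sum_congr rfl fun _ _ => Finset.sum_congr rfl fun _ _ => by ring
  simp only
  rw [h2, inner_self_eq_ofReal_norm_sq]
  exact Complex.zero_le_real.2 (sq_nonneg _)

end MatrixCoefficients

/-! ### The induced map on `ℂ[Γ]` -/

section InducedMap

variable {G : Type u} [Group G] {H : Subgroup G}
variable {K : Type w} [NormedAddCommGroup K] [InnerProductSpace ℂ K] [CompleteSpace K]
variable {E : Type v} [NormedAddCommGroup E] [InnerProductSpace ℂ E]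

theorem mem_spanOver_of_support {Γ : Set (G ⧸ H)} (x : MonoidAlgebra ℂ G)
    (hx : ∀ g ∈ x.coeff.support, (g : G ⧸ H) ∈ Γ) : x ∈ spanOver Γ := by
  have : x = x.coeff.sum fun g c => c • MonoidAlgebra.of ℂ G g := by
    simpa [Finsupp.sum] using (MonoidAlgebra.lift_unique (AlgHom.id ℂ (MonoidAlgebra ℂ G)) x)
  rw [this]
  exact Submodule.sum_mem _ fun g hg => Submodule.smul_mem _ _ (of_mem_spanOver (hx g hg))

theorem inner_algRep_apply (π : G →* unitary (K →L[ℂ] K)) (x : MonoidAlgebra ℂ G) (ξ η : K) :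
    inner ℂ ξ (algRep π x η) =
      Finsupp.linearCombination ℂ (fun g => inner ℂ ξ ((π g : K →L[ℂ] K) η)) x.coeff := by
  induction x using MonoidAlgebra.induction_linear with
  | zero => simp
  | add x y hx hy => simp [hx, hy]
  | single g c => simp [algRep]

open Classical in
theorem inner_inducedMap_apply (Γ : Set (G ⧸ H)) (φ : Γ → (E →L[ℂ] E)) (x : spanOver Γ) (ξ η : E) :
    inner ℂ ξ (inducedMap Γ φ x η) =
      Finsupp.linearCombination ℂ
        (fun g : G => if hg : (g : G ⧸ H) ∈ Γ then inner ℂ ξ (φ ⟨(g : G ⧸ H), hg⟩ η) else 0)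
        (x : MonoidAlgebra ℂ G).coeff := by
  simp only [inducedMap, LinearMap.domRestrict_apply, LinearMap.comp_apply,
    Finsupp.linearCombination_apply]
  simp only [Finsupp.sum, sum_apply, inner_sum]
  refine Finset.sum_congr rfl fun g _ => ?_
  by_cases hg : (g : G ⧸ H) ∈ Γ <;> simp [hg, inner_smul_right]

/-- If `φ` is a compression of `π`, then so is the map it induces on `ℂ[Γ]`. -/
theorem inducedMap_eq_compression [CompleteSpace E] (Γ : Set (G ⧸ H)) (φ : Γ → (E →L[ℂ] E))
    (π : G →* unitary (K →L[ℂ] K)) (V : E →L[ℂ] K)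
    (h : ∀ (g : G) (hg : (g : G ⧸ H) ∈ Γ), φ ⟨(g : G ⧸ H), hg⟩ =
      (ContinuousLinearMap.adjoint V) ∘L (π g : K →L[ℂ] K) ∘L V) (x : spanOver Γ) :
    inducedMap Γ φ x = (ContinuousLinearMap.adjoint V) ∘L (algRep π x) ∘L V := by
  obtain ⟨x, hx⟩ := x
  induction hx using Submodule.span_induction with
  | mem x hx =>
    obtain ⟨g, hg, rfl⟩ := hx
    rw [inducedMap_of Γ φ g hg, h g hg]
    simp [algRep]
  | zero =>
    have : (⟨0, zero_mem _⟩ : spanOver Γ) = 0 := rfl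
    rw [this]; ext; simp
  | add x y hx hy h₁ h₂ =>
    have : (⟨x + y, add_mem hx hy⟩ : spanOver Γ) = ⟨x, hx⟩ + ⟨y, hy⟩ := rfl
    rw [this, map_add, h₁, h₂]; ext; simp
  | smul c x hx h₁ =>
    have : (⟨c • x, Submodule.smul_mem _ c hx⟩ : spanOver Γ) = c • ⟨x, hx⟩ := rfl
    rw [this, map_smul, h₁]; ext; simp

theorem isPartialCPD_of_compression {K : Type (max u v)} [NormedAddCommGroup K]
    [InnerProductSpace ℂ K] [CompleteSpace K] [CompleteSpace E]
    (Γ : Set (G ⧸ H)) (φ : Γ → (E →L[ℂ] E))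
    (π : G →* unitary (K →L[ℂ] K)) (V : E →L[ℂ] K)
    (h : ∀ (g : G) (hg : (g : G ⧸ H) ∈ Γ), φ ⟨(g : G ⧸ H), hg⟩ =
      (ContinuousLinearMap.adjoint V) ∘L (π g : K →L[ℂ] K) ∘L V) : IsPartialCPD Γ φ := by
  intro n x hx ξ
  have := hx K π (fun i => V (ξ i))
  simpa [inducedMap_eq_compression Γ φ π V h, ContinuousLinearMap.adjoint_inner_right] using this

open Classical in
/-- Complete positivity of `φ`, restated for the functional `(ξ, η, g) ↦ ⟪ξ, φ(gH) η⟫` on finitely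
supported `E × E` matrices with entries in `ℂ[Γ]`. -/
theorem IsPartialCPD.nonneg {Γ : Set (G ⧸ H)} {φ : Γ → (E →L[ℂ] E)} (hφ : IsPartialCPD Γ φ)
    (z : E × E × G →₀ ℂ)
    (hzΓ : z ∈ Finsupp.supported ℂ ℂ {t : E × E × G | (t.2.2 : G ⧸ H) ∈ Γ})
    (hz : ∀ a ∈ matrixCoefficients G E, 0 ≤ Finsupp.linearCombination ℂ a z) :
    0 ≤ Finsupp.linearCombination ℂ (fun t : E × E × G =>
      if hg : (t.2.2 : G ⧸ H) ∈ Γ then inner ℂ t.1 (φ ⟨(t.2.2 : G ⧸ H), hg⟩ t.2.1) else 0) z := by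
  obtain ⟨n, p, hp, hsum⟩ := exists_sum_block z
  have hmem : ∀ i j, block z (p i) (p j) ∈ spanOver Γ := fun i j =>
    mem_spanOver_of_support _ fun g hg => by
      have : (p i, p j, g) ∈ z.support := by
        rwa [Finsupp.mem_support_iff, block_coeff_apply, ← Finsupp.mem_support_iff] at hg
      exact hzΓ this
  have h := hφ n (Matrix.of fun i j => ⟨block z (p i) (p j), hmem i j⟩) (by
    intro K _ _ _ π ζ
    have := hz _ ⟨K, _, _, inferInstance, π, Function.extend p ζ 0, rfl⟩
    rw [hsum] at this
    simpa [inner_algRep_apply, hp.extend_apply] using this) p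
  rw [hsum]
  simpa [inner_inducedMap_apply] using h


end InducedMap

/-! ### Dilation -/

/-- A map whose Gram kernel is a bounded sesquilinear form is itself linear and bounded. -/
theorem exists_continuousLinearMap_of_inner {E : Type v} [NormedAddCommGroup E]
    [InnerProductSpace ℂ E] {K : Type w} [NormedAddCommGroup K] [InnerProductSpace ℂ K]
    (J : E → K) (P : E →L[ℂ] E) (hJ : ∀ ξ η, inner ℂ (J ξ) (J η) = inner ℂ ξ (P η)) :
    ∃ V : E →L[ℂ] K, ∀ ξ, V ξ = J ξ := by
  have hadd : ∀ ξ η, J (ξ + η) = J ξ + J η := fun ξ η => by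
    rw [← sub_eq_zero, ← inner_self_eq_zero (𝕜 := ℂ)]
    simp only [inner_sub_left, inner_sub_right, inner_add_left, inner_add_right, hJ, map_add]
    ring
  have hsmul : ∀ (c : ℂ) ξ, J (c • ξ) = c • J ξ := fun c ξ => by
    rw [← sub_eq_zero, ← inner_self_eq_zero (𝕜 := ℂ)]
    simp only [inner_sub_left, inner_sub_right, inner_smul_left, inner_smul_right, hJ, map_smul]
    ring
  refine ⟨LinearMap.mkContinuous ⟨⟨J, hadd⟩, hsmul⟩ √‖P‖ fun ξ => ?_, fun ξ => rfl⟩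
  refine (sq_le_sq₀ (norm_nonneg _) (by positivity)).1 ?_
  rw [mul_pow, Real.sq_sqrt (norm_nonneg _), ← inner_self_eq_norm_sq (𝕜 := ℂ)]
  change RCLike.re (inner ℂ (J ξ) (J ξ)) ≤ _
  rw [hJ]
  calc RCLike.re (inner ℂ ξ (P ξ)) ≤ ‖ξ‖ * ‖P ξ‖ := re_inner_le_norm _ _
    _ ≤ ‖ξ‖ * (‖P‖ * ‖ξ‖) := by gcongr; exact P.le_opNorm ξ
    _ = ‖P‖ * ‖ξ‖ ^ 2 := by ring

section Dilation

variable {G : Type u} [Group G] {H : Subgroup G}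
variable {E : Type v} [NormedAddCommGroup E] [InnerProductSpace ℂ E] [CompleteSpace E]

/-- Dilation of a partially defined completely positive definite function. Fixedness of `V ξ` under
`H` comes from `⟪V ξ, π h (V ξ)⟫ = ⟪V ξ, V ξ⟫`, as `φ` has the same value at `h` and at `1`. -/
theorem IsPartialCPD.exists_compression {Γ : Set (G ⧸ H)} (hsymm : IsSymmetric Γ)
    (harch : IsArchimedean Γ) {φ : Γ → (E →L[ℂ] E)} (hφ : IsPartialCPD Γ φ) :
    ∃ (K : Type (max u v)) (_ : NormedAddCommGroup K) (_ : InnerProductSpace ℂ K)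
      (_ : CompleteSpace K) (π : G →* unitary (K →L[ℂ] K)) (V : E →L[ℂ] K),
      V.range ≤ fixedVectors H π ∧
      ∀ (g : G) (hg : (g : G ⧸ H) ∈ Γ), φ ⟨(g : G ⧸ H), hg⟩ =
        (ContinuousLinearMap.adjoint V) ∘L (π g : K →L[ℂ] K) ∘L V := by
  obtain ⟨b, hbΓ, hbconj, hbpos⟩ := Finsupp.exists_nonneg_extension (matrixCoefficients G E)
    (fun t => (t.2.1, t.1, t.2.2⁻¹)) {t | (t.2.2 : G ⧸ H) ∈ Γ} (fun t ht => hsymm _ ht)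
    (fun a ha t => matrixCoefficients_conj ha t)
    (fun t => ⟨Finsupp.single (t.1, t.1, 1) 1 + Finsupp.single (t.2.1, t.2.1, 1) 1,
      add_mem (Finsupp.single_mem_supported ℂ _ harch) (Finsupp.single_mem_supported ℂ _ harch),
      fun a ha => by simpa using norm_le_matrixCoefficients ha t⟩) _ hφ.nonneg
  obtain ⟨K, _, _, _, ψ, hψ, hdense⟩ := exists_hilbertSpace_of_kernel
    (fun x y : E × G => b (x.1, y.1, x.2⁻¹ * y.2))
    (fun x y => by rw [← hbconj]; simp) (fun c => by
      have := hbpos (c.sum fun x s => c.sum fun y t =>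
        Finsupp.single (x.1, y.1, x.2⁻¹ * y.2) (conj s * t)) fun a ha => by
          simp only [map_finsuppSum, Finsupp.linearCombination_single, smul_eq_mul]
          exact matrixCoefficients_gram_nonneg ha c
      simp only [map_finsuppSum, Finsupp.linearCombination_single, smul_eq_mul] at this
      exact (Complex.le_def.1 this).1)
  -- `G` translates the second factor of `E × G`
  let _ : MulAction G (E × G) :=
    { smul g x := (x.1, g * x.2)
      one_smul x := Prod.ext rfl (one_mul _)
      mul_smul g h x := Prod.ext rfl (mul_assoc _ _ _) }
  have hsm : ∀ (g : G) (x : E × G), g • x = (x.1, g * x.2) := fun _ _ => rfl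
  obtain ⟨π, hπ⟩ := exists_unitaryRep_of_kernel (G := G) ψ hdense fun g x y => by
    simp [hψ, hsm, mul_assoc]
  have hin : ∀ (g : G) (hg : (g : G ⧸ H) ∈ Γ) (ξ η : E),
      inner ℂ (ψ (ξ, 1)) ((π g : K →L[ℂ] K) (ψ (η, 1))) = inner ℂ ξ (φ ⟨(g : G ⧸ H), hg⟩ η) := by
    intro g hg ξ η
    rw [hπ, hψ, hsm, hbΓ _ (by simpa using hg)]
    simp [hg]
  obtain ⟨V, hV⟩ := exists_continuousLinearMap_of_inner (fun ξ => ψ (ξ, 1)) (φ ⟨_, harch⟩)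
    fun ξ η => by simpa using hin 1 harch ξ η
  refine ⟨K, _, _, _, π, V, ?_, fun g hg => ?_⟩
  · rintro _ ⟨ξ, rfl⟩ h hh
    have hcoset : ((h : G) : G ⧸ H) = ((1 : G) : G ⧸ H) :=
      (QuotientGroup.eq.2 (by simpa using hh))
    have hhΓ : (h : G ⧸ H) ∈ Γ := by rw [hcoset]; exact harch
    have h1 : inner ℂ (V ξ) ((π h : K →L[ℂ] K) (V ξ)) = inner ℂ (V ξ) (V ξ) := by
      have e1 := hin h hhΓ ξ ξ
      have e2 := hin 1 harch ξ ξ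
      have e3 : φ ⟨(h : G ⧸ H), hhΓ⟩ = φ ⟨((1 : G) : G ⧸ H), harch⟩ :=
        congrArg φ (Subtype.ext hcoset)
      simp only [hV]
      rw [e1, e3, ← e2]
      simp
    have h2 : inner ℂ ((π h : K →L[ℂ] K) (V ξ)) (V ξ) = inner ℂ (V ξ) (V ξ) := by
      rw [← inner_conj_symm, h1, inner_conj_symm]
    change (π h : K →L[ℂ] K) (V ξ) = V ξ
    rw [← sub_eq_zero, ← inner_self_eq_zero (𝕜 := ℂ)]
    simp only [inner_sub_left, inner_sub_right, Unitary.inner_map_map, h1, h2]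
    ring
  · ext η
    refine ext_inner_left ℂ fun ξ => ?_
    rw [← hin g hg, ContinuousLinearMap.comp_apply, ContinuousLinearMap.adjoint_inner_right,
      ContinuousLinearMap.comp_apply, hV, hV]

/-- The dilation can be taken of class one. If `V ≠ 0` it is so automatically; if `V = 0`, then
`φ = 0` and the trivial one-dimensional representation serves. -/
theorem IsPartialCPD.exists_classOne_compression {Γ : Set (G ⧸ H)} (hsymm : IsSymmetric Γ)
    (harch : IsArchimedean Γ) {φ : Γ → (E →L[ℂ] E)} (hφ : IsPartialCPD Γ φ) :
    ∃ (K : Type (max u v)) (_ : NormedAddCommGroup K) (_ : InnerProductSpace ℂ K)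
      (_ : CompleteSpace K) (π : G →* unitary (K →L[ℂ] K)) (V : E →L[ℂ] K),
      IsClassOne H π ∧ V.range ≤ fixedVectors H π ∧
      ∀ (g : G) (hg : (g : G ⧸ H) ∈ Γ), φ ⟨(g : G ⧸ H), hg⟩ =
        (ContinuousLinearMap.adjoint V) ∘L (π g : K →L[ℂ] K) ∘L V := by
  obtain ⟨K, _, _, _, π, V, hVH, hV⟩ := hφ.exists_compression hsymm harch
  by_cases h0 : V = 0
  · subst h0
    refine ⟨EuclideanSpace ℂ PUnit.{max u v + 1}, inferInstance, inferInstance, inferInstance,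
      1, 0, ?_, ?_, ?_⟩
    · intro hbot
      have hmem : EuclideanSpace.single PUnit.unit (1 : ℂ) ∈
          fixedVectors H (1 : G →* unitary (EuclideanSpace ℂ PUnit.{max u v + 1} →L[ℂ] _)) :=
        fun h _ => rfl
      rw [hbot, Submodule.mem_bot] at hmem
      simp at hmem
    · rintro _ ⟨ξ, rfl⟩ h _
      rfl
    · intro g hg
      rw [hV g hg]
      ext; simp
  · refine ⟨K, _, _, _, π, V, fun hbot => h0 ?_, hVH, hV⟩
    ext ξ
    have : V ξ ∈ fixedVectors H π := hVH ⟨ξ, rfl⟩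
    simpa [hbot] using this

theorem isometry_iff_adjoint_comp_map_one {K : Type w} [NormedAddCommGroup K]
    [InnerProductSpace ℂ K] [CompleteSpace K] (π : G →* unitary (K →L[ℂ] K)) (V : E →L[ℂ] K) :
    Isometry V ↔ (ContinuousLinearMap.adjoint V) ∘L (π 1 : K →L[ℂ] K) ∘L V =
      ContinuousLinearMap.id ℂ E := by
  rw [AddMonoidHomClass.isometry_iff_norm, ContinuousLinearMap.norm_map_iff_adjoint_comp_self,
    map_one]
  rfl

end Dilation

end PartialCPD

end Auxiliary

theorem mainTheorem4
    {G : Type u} [Group G] (H : Subgroup G)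
    {E : Type v} [NormedAddCommGroup E] [InnerProductSpace ℂ E] [CompleteSpace E]
    (Γ : Set (G ⧸ H)) (hsymm : PartialCPD.IsSymmetric Γ) (harch : PartialCPD.IsArchimedean Γ)
    (φ : Γ → (E →L[ℂ] E)) :
    (PartialCPD.IsPartialCPD Γ φ ↔
      ∃ (K : Type (max u v)) (_ : NormedAddCommGroup K) (_ : InnerProductSpace ℂ K)
        (_ : CompleteSpace K) (π : G →* unitary (K →L[ℂ] K)) (V : E →L[ℂ] K),
        PartialCPD.IsClassOne H π ∧
        V.range ≤ PartialCPD.fixedVectors H π ∧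
        ∀ (g : G) (hg : (g : G ⧸ H) ∈ Γ),
          φ ⟨(g : G ⧸ H), hg⟩ =
            (ContinuousLinearMap.adjoint V) ∘L (π g : K →L[ℂ] K) ∘L V) ∧
    ((PartialCPD.IsPartialCPD Γ φ ∧ φ ⟨((1 : G) : G ⧸ H), harch⟩ = ContinuousLinearMap.id ℂ E) ↔
      ∃ (K : Type (max u v)) (_ : NormedAddCommGroup K) (_ : InnerProductSpace ℂ K)
        (_ : CompleteSpace K) (π : G →* unitary (K →L[ℂ] K)) (V : E →L[ℂ] K),
        PartialCPD.IsClassOne H π ∧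
        Isometry V ∧
        V.range ≤ PartialCPD.fixedVectors H π ∧
        ∀ (g : G) (hg : (g : G ⧸ H) ∈ Γ),
          φ ⟨(g : G ⧸ H), hg⟩ =
            (ContinuousLinearMap.adjoint V) ∘L (π g : K →L[ℂ] K) ∘L V) := by
  refine ⟨⟨fun hφ => hφ.exists_classOne_compression hsymm harch, ?_⟩, ⟨?_, ?_⟩⟩
  · rintro ⟨K, _, _, _, π, V, -, -, hV⟩
    exact PartialCPD.isPartialCPD_of_compression Γ φ π V hV
  · rintro ⟨hφ, hone⟩
    obtain ⟨K, _, _, _, π, V, hπ, hVH, hV⟩ := hφ.exists_classOne_compression hsymm harch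
    refine ⟨K, _, _, _, π, V, hπ, ?_, hVH, hV⟩
    rw [PartialCPD.isometry_iff_adjoint_comp_map_one π, ← hV 1 harch, hone]
  · rintro ⟨K, _, _, _, π, V, -, hiso, -, hV⟩
    refine ⟨PartialCPD.isPartialCPD_of_compression Γ φ π V hV, ?_⟩
    rw [hV 1 harch, ← PartialCPD.isometry_iff_adjoint_comp_map_one π]
    exact hiso
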